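/- **Proposition.** Let $G$ be a group, regarded as a category $\mathcal G$ with a single object $A$ and $\mathrm{Hom}(A,A)=G$ (composition being the multiplication of $G$). Let $\mathcal C$ be the free strict symmetric monoidal category generated by $\mathcal G$, that is, the strict symmetric monoidal category with an inclusion functor $\mathcal G\to\mathcal C$ such that every functor from $\mathcal G$ to a strict symmetric monoidal category extends uniquely to a strict symmetric monoidal functor on $\mathcal C$. Write again $A$ and $g$ for the images in $\mathcal C$ of the object $A$ and of $g\in G$, and let $\gamma\colon A\otimes A\to A\otimes A$ be the braiding. For every integer $n\ge 0$, let $G\wr S_n=G^n\rtimes S_n$ be the wreath product, where $S_n$ acts on $G^n$ by $(\sigma\cdot g)_i=g_{\sigma^{-1}(i)}$. Then there is a group isomorphism $$G\wr S_n\;\cong\;\mathrm{Hom}_{\mathcal C}(A^{\otimes n},A^{\otimes n})$$ (in particular every endomorphism of $A^{\otimes n}$ is invertible). More precisely, there is a homomorphism $P\colon S_n\to \mathrm{Hom}_{\mathcal C}(A^{\otimes n},A^{\otimes n})$ sending each adjacent transposition $(i\;\,i{+}1)$, $1\le i<n$, to $\mathrm{id}\otimes\cdots\otimes\mathrm{id}\otimes\gamma\otimes\mathrm{id}\otimes\cdots\otimes\mathrm{id}$,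 with $\gamma$ acting on the factors $i$ and $i+1$, such that the isomorphism sends $(g_1,\dots,g_n;\sigma)$ to $(g_1\otimes\cdots\otimes g_n)\circ P(\sigma)$; and every endomorphism of $A^{\otimes n}$ can be written as $(g_1\otimes\cdots\otimes g_n)\circ P(\sigma)$ for exactly one tuple $(g_1,\dots,g_n)\in G^n$ and exactly one $\sigma\in S_n$. -/

import Mathlib

open CategoryTheory MonoidalCategory

universe w v u v₁ u₁

/-- A monoidal category is strict if its tensor product is associative and unital on the nose and
its associators and unitors are identities. -/
class IsStrictMonoidal (C : Type u) [Category.{v} C] [MonoidalCategory C] : Prop where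
  tensor_assoc : ∀ X Y Z : C, (X ⊗ Y) ⊗ Z = X ⊗ (Y ⊗ Z)
  unit_tensor : ∀ X : C, 𝟙_ C ⊗ X = X
  tensor_unit : ∀ X : C, X ⊗ 𝟙_ C = X
  associator_eq : ∀ X Y Z : C, (α_ X Y Z).hom = eqToHom (tensor_assoc X Y Z)
  leftUnitor_eq : ∀ X : C, (λ_ X).hom = eqToHom (unit_tensor X)
  rightUnitor_eq : ∀ X : C, (ρ_ X).hom = eqToHom (tensor_unit X)

/-- A strict symmetric monoidal functor preserves the unit object, the tensor product (of objects
and of morphisms) and the braiding on the nose. -/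
structure IsStrictSymmetricFunctor {C : Type u} [Category.{v} C] [MonoidalCategory C]
    [SymmetricCategory C] {D : Type u₁} [Category.{v₁} D] [MonoidalCategory D]
    [SymmetricCategory D] (F : C ⥤ D) : Prop where
  obj_unit : F.obj (𝟙_ C) = 𝟙_ D
  obj_tensor : ∀ X Y : C, F.obj (X ⊗ Y) = F.obj X ⊗ F.obj Y
  map_tensor : ∀ {X Y X' Y' : C} (f : X ⟶ Y) (g : X' ⟶ Y'),
    F.map (f ⊗ₘ g) =
      eqToHom (obj_tensor X X') ≫ (F.map f ⊗ₘ F.map g) ≫ eqToHom (obj_tensor Y Y').symm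
  map_braiding : ∀ X Y : C,
    F.map (β_ X Y).hom =
      eqToHom (obj_tensor X Y) ≫ (β_ (F.obj X) (F.obj Y)).hom ≫ eqToHom (obj_tensor Y X).symm

/-! ### The free strict symmetric monoidal category on a category -/

section Free

variable (B : Type u) [Category.{v} B]

/-- Objects of the free strict symmetric monoidal category on `B`: words in the objects of `B`,
with concatenation as tensor product and the empty word as unit. -/
def FreeSSMC (B : Type u) : Type u := List B

namespace FreeSSMC

variable {B}

/-- Formal morphisms: the morphisms of `B`, identities (written along equalities of words), and
braidings, closed under composition and tensor product. -/
inductive PreHom : List B → List B → Type (max u v)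
  | of {X Y : B} (f : X ⟶ Y) : PreHom [X] [Y]
  | eqTo {X Y : List B} (h : X = Y) : PreHom X Y
  | comp {X Y Z : List B} (f : PreHom X Y) (g : PreHom Y Z) : PreHom X Z
  | tensor {X Y X' Y' : List B} (f : PreHom X Y) (g : PreHom X' Y') : PreHom (X ++ X') (Y ++ Y')
  | braid (X Y : List B) : PreHom (X ++ Y) (Y ++ X)

/-- The formal identity morphism. -/
abbrev PreHom.id (X : List B) : PreHom X X := PreHom.eqTo rfl

open PreHom in
/-- The congruence on formal morphisms generated by: the composition and identities of `B`, and
the axioms of a strict symmetric monoidal category. -/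
inductive Rel : ∀ {X Y : List B}, PreHom X Y → PreHom X Y → Prop
  | refl {X Y} (f : PreHom X Y) : Rel f f
  | symm {X Y} {f g : PreHom X Y} : Rel f g → Rel g f
  | trans {X Y} {f g h : PreHom X Y} : Rel f g → Rel g h → Rel f h
  | comp_congr {X Y Z} {f f' : PreHom X Y} {g g' : PreHom Y Z} :
      Rel f f' → Rel g g' → Rel (f.comp g) (f'.comp g')
  | tensor_congr {X Y X' Y'} {f f' : PreHom X Y} {g g' : PreHom X' Y'} :
      Rel f f' → Rel g g' → Rel (f.tensor g) (f'.tensor g')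
  | of_id (X : B) : Rel (of (𝟙 X)) (PreHom.id [X])
  | of_comp {X Y Z : B} (f : X ⟶ Y) (g : Y ⟶ Z) : Rel (of (f ≫ g)) ((of f).comp (of g))
  | id_comp {X Y} (f : PreHom X Y) : Rel ((PreHom.id X).comp f) f
  | comp_id {X Y} (f : PreHom X Y) : Rel (f.comp (PreHom.id Y)) f
  | assoc {W X Y Z} (f : PreHom W X) (g : PreHom X Y) (h : PreHom Y Z) :
      Rel ((f.comp g).comp h) (f.comp (g.comp h))
  | id_tensor_id (X Y : List B) : Rel ((PreHom.id X).tensor (PreHom.id Y)) (PreHom.id (X ++ Y))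
  | tensor_comp_tensor {X Y Z X' Y' Z'} (f : PreHom X Y) (g : PreHom Y Z)
      (f' : PreHom X' Y') (g' : PreHom Y' Z') :
      Rel ((f.tensor f').comp (g.tensor g')) ((f.comp g).tensor (f'.comp g'))
  | tensor_assoc {X Y X' Y' X'' Y''} (f : PreHom X Y) (f' : PreHom X' Y') (f'' : PreHom X'' Y'') :
      Rel (((f.tensor f').tensor f'').comp (eqTo (List.append_assoc Y Y' Y'')))
        ((eqTo (List.append_assoc X X' X'')).comp (f.tensor (f'.tensor f'')))
  | unit_tensor {X Y} (f : PreHom X Y) :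
      Rel (((PreHom.id []).tensor f).comp (eqTo (List.nil_append Y)))
        ((eqTo (List.nil_append X)).comp f)
  | tensor_unit {X Y} (f : PreHom X Y) :
      Rel ((f.tensor (PreHom.id [])).comp (eqTo (List.append_nil Y)))
        ((eqTo (List.append_nil X)).comp f)
  | braid_naturality {X Y X' Y'} (f : PreHom X Y) (f' : PreHom X' Y') :
      Rel ((f.tensor f').comp (braid Y Y')) ((braid X X').comp (f'.tensor f))
  | hexagon_forward (X Y Z : List B) :
      Rel ((eqTo (List.append_assoc X Y Z)).comp
          ((braid X (Y ++ Z)).comp (eqTo (List.append_assoc Y Z X))))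
        (((braid X Y).tensor (PreHom.id Z)).comp
          ((eqTo (List.append_assoc Y X Z)).comp ((PreHom.id Y).tensor (braid X Z))))
  | hexagon_reverse (X Y Z : List B) :
      Rel ((eqTo (List.append_assoc X Y Z).symm).comp
          ((braid (X ++ Y) Z).comp (eqTo (List.append_assoc Z X Y).symm)))
        (((PreHom.id X).tensor (braid Y Z)).comp
          ((eqTo (List.append_assoc X Z Y).symm).comp ((braid X Z).tensor (PreHom.id Y))))
  | symmetry (X Y : List B) : Rel ((braid X Y).comp (braid Y X)) (PreHom.id (X ++ Y))

instance relSetoid (X Y : List B) : Setoid (PreHom X Y) :=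
  ⟨Rel, Rel.refl, Rel.symm, Rel.trans⟩

instance : Category.{max u v} (FreeSSMC B) where
  Hom X Y := Quotient (relSetoid (B := B) X Y)
  id X := Quotient.mk _ (PreHom.id X)
  comp := Quotient.map₂ PreHom.comp fun _ _ h _ _ h' => Rel.comp_congr h h'
  id_comp := by rintro X Y ⟨f⟩; exact Quotient.sound (Rel.id_comp f)
  comp_id := by rintro X Y ⟨f⟩; exact Quotient.sound (Rel.comp_id f)
  assoc := by rintro W X Y Z ⟨f⟩ ⟨g⟩ ⟨h⟩; exact Quotient.sound (Rel.assoc f g h)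

/-- The class of a formal morphism. -/
def homMk {X Y : List B} (f : PreHom X Y) : @Quiver.Hom (FreeSSMC B) _ X Y := Quotient.mk _ f

lemma homMk_comp {X Y Z : List B} (f : PreHom X Y) (g : PreHom Y Z) :
    homMk (f.comp g) = homMk f ≫ homMk g := rfl

lemma homMk_eqTo {X Y : List B} (h : X = Y) :
    homMk (PreHom.eqTo h) = eqToHom (C := FreeSSMC B) h := by
  subst h; rfl

/-- An equality of words as an isomorphism. -/
def isoOfEq {X Y : List B} (h : X = Y) : @Iso (FreeSSMC B) _ X Y where
  hom := homMk (PreHom.eqTo h)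
  inv := homMk (PreHom.eqTo h.symm)
  hom_inv_id := by subst h; exact Quotient.sound (Rel.id_comp _)
  inv_hom_id := by subst h; exact Quotient.sound (Rel.id_comp _)

/-- Tensor product of morphisms. -/
def tensorMap {X Y X' Y' : FreeSSMC B} (f : X ⟶ Y) (g : X' ⟶ Y') :
    @Quiver.Hom (FreeSSMC B) _ (List.append X X') (List.append Y Y') :=
  Quotient.map₂ PreHom.tensor (fun _ _ h _ _ h' => Rel.tensor_congr h h') f g

instance : MonoidalCategoryStruct (FreeSSMC B) where
  tensorObj X Y := List.append X Y
  tensorUnit := ([] : List B)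
  tensorHom f g := tensorMap f g
  whiskerLeft X _ _ f := tensorMap (𝟙 X) f
  whiskerRight f Y := tensorMap f (𝟙 Y)
  associator X Y Z := isoOfEq (List.append_assoc X Y Z)
  leftUnitor X := isoOfEq (List.nil_append X)
  rightUnitor X := isoOfEq (List.append_nil X)

lemma homMk_tensor {X Y X' Y' : List B} (f : PreHom X Y) (g : PreHom X' Y') :
    homMk (f.tensor g) = homMk f ⊗ₘ homMk g := rfl

lemma tensorMap_eqTo {X Y X' Y' : List B} (h : X = Y) (h' : X' = Y') :
    tensorMap (homMk (PreHom.eqTo h)) (homMk (PreHom.eqTo h')) =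
      homMk (PreHom.eqTo (congrArg₂ (· ++ ·) h h')) := by
  subst h h'; exact Quotient.sound (Rel.id_tensor_id _ _)

lemma eqTo_comp_eqTo {X Y Z : List B} (h : X = Y) (h' : Y = Z) :
    homMk (PreHom.eqTo h) ≫ homMk (PreHom.eqTo h') = homMk (PreHom.eqTo (h.trans h')) := by
  subst h h'; exact Quotient.sound (Rel.id_comp _)

instance : MonoidalCategory (FreeSSMC B) := MonoidalCategory.ofTensorHom
  (id_tensorHom_id := fun X Y => Quotient.sound (Rel.id_tensor_id _ _))
  (tensorHom_comp_tensorHom := by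
    rintro X₁ Y₁ Z₁ X₂ Y₂ Z₂ ⟨f₁⟩ ⟨f₂⟩ ⟨g₁⟩ ⟨g₂⟩
    exact Quotient.sound (Rel.tensor_comp_tensor f₁ g₁ f₂ g₂))
  (associator_naturality := by
    rintro X₁ X₂ X₃ Y₁ Y₂ Y₃ ⟨f₁⟩ ⟨f₂⟩ ⟨f₃⟩
    exact Quotient.sound (Rel.tensor_assoc f₁ f₂ f₃))
  (leftUnitor_naturality := by
    rintro X Y ⟨f⟩
    exact Quotient.sound (Rel.unit_tensor f))
  (rightUnitor_naturality := by
    rintro X Y ⟨f⟩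
    exact Quotient.sound (Rel.tensor_unit f))
  (pentagon := fun W X Y Z => by
    refine (congrArg₂ (· ≫ ·) (tensorMap_eqTo _ rfl)
      (congrArg₂ (· ≫ ·) rfl (tensorMap_eqTo rfl _))).trans ?_
    refine (congrArg (_ ≫ ·) (eqTo_comp_eqTo _ _)).trans ?_
    exact (eqTo_comp_eqTo _ _).trans (eqTo_comp_eqTo _ _).symm)
  (triangle := fun X Y => by
    refine (congrArg (_ ≫ ·) (tensorMap_eqTo rfl _)).trans ?_
    exact (eqTo_comp_eqTo _ _).trans (tensorMap_eqTo _ rfl).symm)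

instance : IsStrictMonoidal (FreeSSMC B) where
  tensor_assoc X Y Z := List.append_assoc X Y Z
  unit_tensor X := List.nil_append X
  tensor_unit X := List.append_nil X
  associator_eq X Y Z := homMk_eqTo (List.append_assoc X Y Z)
  leftUnitor_eq X := homMk_eqTo (List.nil_append X)
  rightUnitor_eq X := homMk_eqTo (List.append_nil X)

instance : SymmetricCategory (FreeSSMC B) where
  braiding X Y :=
    { hom := homMk (PreHom.braid X Y)
      inv := homMk (PreHom.braid Y X)
      hom_inv_id := Quotient.sound (Rel.symmetry X Y)
      inv_hom_id := Quotient.sound (Rel.symmetry Y X) }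
  braiding_naturality_right := by
    rintro X Y Z ⟨f⟩
    exact Quotient.sound (Rel.braid_naturality (PreHom.id X) f)
  braiding_naturality_left := by
    rintro X Y ⟨f⟩ Z
    exact Quotient.sound (Rel.braid_naturality f (PreHom.id Z))
  hexagon_forward X Y Z := Quotient.sound (Rel.hexagon_forward X Y Z)
  hexagon_reverse X Y Z := Quotient.sound (Rel.hexagon_reverse X Y Z)
  symmetry X Y := Quotient.sound (Rel.symmetry X Y)

variable (B) in
/-- The inclusion of the generating category. -/
def incl : B ⥤ FreeSSMC B where
  obj X := ([X] : List B)
  map f := homMk (PreHom.of f)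
  map_id X := Quotient.sound (Rel.of_id X)
  map_comp f g := Quotient.sound (Rel.of_comp f g)

/-! #### The universal property -/

section Lift

variable {D : Type u₁} [Category.{v₁} D] [MonoidalCategory D]

lemma eqToHom_tensor_eqToHom {X Y X' Y' : D} (h : X = Y) (h' : X' = Y') :
    eqToHom h ⊗ₘ eqToHom h' = eqToHom (congrArg₂ (fun a b : D => a ⊗ b) h h') := by
  subst h h'; simp

lemma tensor_eqToHom_conj {X Y X' Y' X₁ Y₁ X₂ Y₂ : D} (f : X ⟶ Y) (g : X' ⟶ Y')
    (h₁ : X₁ = X) (h₂ : Y = Y₁) (h₃ : X₂ = X') (h₄ : Y' = Y₂) :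
    (eqToHom h₁ ≫ f ≫ eqToHom h₂) ⊗ₘ (eqToHom h₃ ≫ g ≫ eqToHom h₄) =
      eqToHom (congrArg₂ (fun a b : D => a ⊗ b) h₁ h₃) ≫ (f ⊗ₘ g) ≫
        eqToHom (congrArg₂ (fun a b : D => a ⊗ b) h₂ h₄) := by
  subst h₁ h₂ h₃ h₄; simp

lemma tensor_eqToHom_left {X Y X' Y' X₁ Y₁ : D} (f : X ⟶ Y) (g : X' ⟶ Y')
    (h₁ : X₁ = X) (h₂ : Y = Y₁) :
    (eqToHom h₁ ≫ f ≫ eqToHom h₂) ⊗ₘ g =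
      eqToHom (congrArg (fun a : D => a ⊗ X') h₁) ≫ (f ⊗ₘ g) ≫
        eqToHom (congrArg (fun a : D => a ⊗ Y') h₂) := by
  subst h₁ h₂; simp

lemma tensor_eqToHom_right {X Y X' Y' X₁ Y₁ : D} (f : X ⟶ Y) (g : X' ⟶ Y')
    (h₁ : X₁ = X') (h₂ : Y' = Y₁) :
    f ⊗ₘ (eqToHom h₁ ≫ g ≫ eqToHom h₂) =
      eqToHom (congrArg (fun a : D => X ⊗ a) h₁) ≫ (f ⊗ₘ g) ≫
        eqToHom (congrArg (fun a : D => Y ⊗ a) h₂) := by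
  subst h₁ h₂; simp

lemma braiding_eqToHom [SymmetricCategory D] {X Y X' Y' : D} (h : X = X') (h' : Y = Y') :
    (β_ X Y).hom = eqToHom (congrArg₂ (fun a b : D => a ⊗ b) h h') ≫ (β_ X' Y').hom ≫
      eqToHom (congrArg₂ (fun a b : D => a ⊗ b) h'.symm h.symm) := by
  subst h h'; simp

variable [IsStrictMonoidal D]

lemma strict_assoc {X Y X' Y' X'' Y'' : D} (f : X ⟶ Y) (f' : X' ⟶ Y') (f'' : X'' ⟶ Y'') :
    (f ⊗ₘ f') ⊗ₘ f'' = eqToHom (IsStrictMonoidal.tensor_assoc _ _ _) ≫ (f ⊗ₘ (f' ⊗ₘ f'')) ≫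
      eqToHom (IsStrictMonoidal.tensor_assoc _ _ _).symm := by
  have := associator_naturality f f' f''
  rw [IsStrictMonoidal.associator_eq, IsStrictMonoidal.associator_eq] at this
  rw [← reassoc_of% this]; simp

lemma strict_assoc_inv (X Y Z : D) :
    (α_ X Y Z).inv = eqToHom (IsStrictMonoidal.tensor_assoc X Y Z).symm := by
  rw [← cancel_epi (α_ X Y Z).hom, Iso.hom_inv_id, IsStrictMonoidal.associator_eq]; simp

lemma strict_left {U X Y : D} (hU : U = 𝟙_ D) (f : X ⟶ Y) :
    𝟙 U ⊗ₘ f = eqToHom ((congrArg (fun a : D => a ⊗ X) hU).trans (IsStrictMonoidal.unit_tensor _)) ≫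
      f ≫ eqToHom ((congrArg (fun a : D => a ⊗ Y) hU).trans
        (IsStrictMonoidal.unit_tensor _)).symm := by
  subst hU
  have := leftUnitor_naturality f
  rw [IsStrictMonoidal.leftUnitor_eq, IsStrictMonoidal.leftUnitor_eq] at this
  rw [← reassoc_of% this]; simp

lemma strict_right {U X Y : D} (hU : U = 𝟙_ D) (f : X ⟶ Y) :
    f ⊗ₘ 𝟙 U = eqToHom ((congrArg (fun a : D => X ⊗ a) hU).trans (IsStrictMonoidal.tensor_unit _)) ≫
      f ≫ eqToHom ((congrArg (fun a : D => Y ⊗ a) hU).trans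
        (IsStrictMonoidal.tensor_unit _)).symm := by
  subst hU
  have := rightUnitor_naturality f
  rw [IsStrictMonoidal.rightUnitor_eq, IsStrictMonoidal.rightUnitor_eq] at this
  rw [← reassoc_of% this]; simp

variable (F : B ⥤ D)

/-- The induced map on objects. -/
def liftObj : List B → D
  | [] => 𝟙_ D
  | X :: l => F.obj X ⊗ liftObj l

lemma liftObj_append (X Y : List B) : liftObj F (X ++ Y) = liftObj F X ⊗ liftObj F Y := by
  induction X with
  | nil => exact (IsStrictMonoidal.unit_tensor _).symm
  | cons a l ih =>
    exact (congrArg (F.obj a ⊗ ·) ih).trans (IsStrictMonoidal.tensor_assoc _ _ _).symm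

lemma liftObj_singleton (X : B) : liftObj F [X] = F.obj X := IsStrictMonoidal.tensor_unit _

variable [SymmetricCategory D]

/-- The induced map on formal morphisms. -/
def liftPre : ∀ {X Y : List B}, PreHom X Y → (liftObj F X ⟶ liftObj F Y)
  | _, _, .of f => eqToHom (liftObj_singleton F _) ≫ F.map f ≫ eqToHom (liftObj_singleton F _).symm
  | _, _, .eqTo h => eqToHom (congrArg (liftObj F) h)
  | _, _, .comp f g => liftPre f ≫ liftPre g
  | _, _, .tensor f g => eqToHom (liftObj_append F _ _) ≫ (liftPre f ⊗ₘ liftPre g) ≫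
      eqToHom (liftObj_append F _ _).symm
  | _, _, .braid X Y => eqToHom (liftObj_append F _ _) ≫ (β_ (liftObj F X) (liftObj F Y)).hom ≫
      eqToHom (liftObj_append F _ _).symm

lemma liftPre_rel {X Y : List B} {f g : PreHom X Y} (h : Rel f g) :
    liftPre F f = liftPre F g := by
  induction h with
  | refl => rfl
  | symm _ ih => exact ih.symm
  | trans _ _ ih ih' => exact ih.trans ih'
  | comp_congr _ _ ih ih' => simp only [liftPre, ih, ih']
  | tensor_congr _ _ ih ih' => simp only [liftPre, ih, ih']
  | of_id => simp [liftPre]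
  | of_comp => simp [liftPre]
  | id_comp => simp [liftPre]
  | comp_id => simp [liftPre]
  | assoc => simp [liftPre]
  | id_tensor_id => simp [liftPre]
  | tensor_comp_tensor => simp [liftPre]
  | tensor_assoc f f' f'' =>
    simp only [liftPre, tensor_eqToHom_left, tensor_eqToHom_right, strict_assoc, Category.assoc,
      eqToHom_trans, eqToHom_trans_assoc]
  | unit_tensor f =>
    simp only [liftPre, eqToHom_refl, strict_left (show liftObj F [] = 𝟙_ D from rfl),
      Category.assoc, eqToHom_trans, eqToHom_trans_assoc, Category.comp_id]
  | tensor_unit f =>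
    simp only [liftPre, eqToHom_refl, strict_right (show liftObj F [] = 𝟙_ D from rfl),
      Category.assoc, eqToHom_trans, eqToHom_trans_assoc, Category.comp_id]
  | braid_naturality f f' => simp [liftPre]
  | hexagon_forward X Y Z =>
    have h := BraidedCategory.hexagon_forward (liftObj F X) (liftObj F Y) (liftObj F Z)
    simp only [← tensorHom_id, ← id_tensorHom, IsStrictMonoidal.associator_eq,
      eqToHom_comp_iff, comp_eqToHom_iff, Category.assoc] at h
    simp only [liftPre, eqToHom_refl, tensor_eqToHom_left, tensor_eqToHom_right,
      braiding_eqToHom rfl (liftObj_append F Y Z), h, Category.assoc, eqToHom_trans_assoc,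
      eqToHom_trans]
  | hexagon_reverse X Y Z =>
    have h := BraidedCategory.hexagon_reverse (liftObj F X) (liftObj F Y) (liftObj F Z)
    simp only [← tensorHom_id, ← id_tensorHom, strict_assoc_inv,
      eqToHom_comp_iff, comp_eqToHom_iff, Category.assoc] at h
    simp only [liftPre, eqToHom_refl, tensor_eqToHom_left, tensor_eqToHom_right,
      braiding_eqToHom (liftObj_append F X Y) rfl, h, Category.assoc, eqToHom_trans_assoc,
      eqToHom_trans]
  | symmetry X Y => simp [liftPre]

/-- The strict symmetric monoidal functor induced by a functor out of `B`. -/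
def lift : FreeSSMC B ⥤ D where
  obj := liftObj F
  map := Quotient.lift (liftPre F) fun _ _ h => liftPre_rel F h
  map_id _ := rfl
  map_comp := by rintro X Y Z ⟨f⟩ ⟨g⟩; rfl

lemma lift_strict : IsStrictSymmetricFunctor (lift F) where
  obj_unit := rfl
  obj_tensor := liftObj_append F
  map_tensor := by rintro X Y X' Y' ⟨f⟩ ⟨g⟩; rfl
  map_braiding _ _ := rfl

lemma incl_lift : incl B ⋙ lift F = F :=
  CategoryTheory.Functor.ext (liftObj_singleton F) fun _ _ _ => rfl

lemma lift_unique (L : FreeSSMC B ⥤ D) (hL : IsStrictSymmetricFunctor L)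
    (h : incl B ⋙ L = F) : L = lift F := by
  subst h
  have ho : ∀ X : List B, L.obj X = liftObj (incl B ⋙ L) X := by
    intro X
    induction X with
    | nil => exact hL.obj_unit
    | cons a l ih =>
      exact (hL.obj_tensor ((incl B).obj a) l).trans (congrArg (L.obj ((incl B).obj a) ⊗ ·) ih)
  have hm : ∀ {X Y : List B} (f : PreHom X Y), L.map (homMk f) =
      eqToHom (ho X) ≫ liftPre (incl B ⋙ L) f ≫ eqToHom (ho Y).symm := by
    intro X Y f
    induction f with
    | of f =>
      simp only [liftPre, Category.assoc, eqToHom_trans, eqToHom_trans_assoc]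
      erw [Category.id_comp, Category.comp_id]
      rfl
    | eqTo e =>
      subst e
      refine (L.map_id _).trans ?_
      simp only [liftPre, eqToHom_refl, Category.id_comp, eqToHom_trans]
    | comp f g ihf ihg =>
      refine (L.map_comp (homMk f) (homMk g)).trans ?_
      rw [ihf, ihg]
      simp only [liftPre, Category.assoc, eqToHom_trans_assoc, eqToHom_refl, Category.id_comp]
    | tensor f g ihf ihg =>
      refine (hL.map_tensor (homMk f) (homMk g)).trans ?_
      rw [ihf, ihg, tensor_eqToHom_conj]
      simp only [liftPre, Category.assoc, eqToHom_trans, eqToHom_trans_assoc]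
    | braid X Y =>
      have := hL.map_braiding X Y
      rw [braiding_eqToHom (ho X) (ho Y)] at this
      refine this.trans ?_
      simp only [liftPre, Category.assoc, eqToHom_trans, eqToHom_trans_assoc]
  refine CategoryTheory.Functor.ext ho ?_
  rintro X Y ⟨f⟩
  exact hm f

/-- The universal property of the free strict symmetric monoidal category: every functor from `B`
to a strict symmetric monoidal category extends uniquely to a strict symmetric monoidal functor. -/
theorem existsUnique_lift : ∃! L : FreeSSMC B ⥤ D, IsStrictSymmetricFunctor L ∧ incl B ⋙ L = F :=
  ⟨lift F, ⟨lift_strict F, incl_lift F⟩, fun L hL => lift_unique F L hL.1 hL.2⟩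

end Lift

end FreeSSMC

end Free

/-! ### Tensor powers, elementary braidings and wreath products -/

section Powers

variable {C : Type u} [Category.{v} C] [MonoidalCategory C]

/-- The tensor power `A ⊗ (A ⊗ ⋯ ⊗ (A ⊗ 𝟙_))`. -/
def tensorPow (A : C) : ℕ → C
  | 0 => 𝟙_ C
  | n + 1 => A ⊗ tensorPow A n

/-- The endomorphism `g 0 ⊗ ⋯ ⊗ g (n - 1)` of the `n`-th tensor power. -/
def tensorPowMap {A : C} : (n : ℕ) → (Fin n → End A) → End (tensorPow A n)
  | 0, _ => 𝟙 (𝟙_ C)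
  | n + 1, g => (show A ⟶ A from g 0) ⊗ₘ
      (show tensorPow A n ⟶ tensorPow A n from tensorPowMap n fun i => g i.succ)

/-- For `i + 1 < n`, the endomorphism `id ⊗ ⋯ ⊗ id ⊗ γ ⊗ id ⊗ ⋯ ⊗ id` of the `n`-th tensor power,
where the braiding `γ` of `A ⊗ A` acts on the factors at positions `i` and `i + 1` (counted from
`0`). The other values of `i` are not used, and give the identity. -/
def elementaryBraiding [SymmetricCategory C] (A : C) : (n i : ℕ) → End (tensorPow A n)
  | 0, _ => 𝟙 _
  | 1, _ => 𝟙 _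
  | n + 2, 0 =>
      (α_ A A (tensorPow A n)).inv ≫ (β_ A A).hom ▷ tensorPow A n ≫ (α_ A A (tensorPow A n)).hom
  | n + 2, i + 1 => A ◁ (show tensorPow A (n + 1) ⟶ tensorPow A (n + 1) from
      elementaryBraiding A (n + 1) i)

end Powers

/-- The wreath product `G ≀ S_n`: the semidirect product of `Gⁿ` and `S_n`, where `S_n` permutes the
`n` copies of `G` by `(σ • g) i = g (σ⁻¹ i)`. -/
abbrev WreathProduct (G : Type w) [Group G] (n : ℕ) : Type w :=
  (Fin n → G) ⋊[mulAutArrow (G := Equiv.Perm (Fin n)) (A := Fin n) (M := G)] Equiv.Perm (Fin n)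

/-- The generating object `A` of the free strict symmetric monoidal category on the one-object
category of the group `G`. -/
abbrev genObj (G : Type w) [Group G] : FreeSSMC (SingleObj G) :=
  (FreeSSMC.incl (SingleObj G)).obj (SingleObj.star G)

/-- The endomorphism of the generating object given by an element of `G`. -/
abbrev genEnd {G : Type w} [Group G] (g : G) : End (genObj G) :=
  (FreeSSMC.incl (SingleObj G)).map (SingleObj.toEnd G g)

/-!
Every endomorphism of `A^{⊗ n}` in the free strict symmetric monoidal category on `G` is
`(g₁ ⊗ ⋯ ⊗ gₙ) ∘ P σ` for exactly one pair `(g, σ)`. There are three ingredients.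

*Existence of `P`.* In any symmetric monoidal category the elementary braidings of `A^{⊗ n}` are
involutions, commute when they are far apart, and satisfy the braid relation, which is the
Yang–Baxter equation. These are the Coxeter relations of the adjacent transpositions, so `P` is
given by the Coxeter presentation of the symmetric group, `exists_perm_hom_of_coxeter`. The
presentation is proved by induction on `n`: every permutation is a transposition `(0 p)` times a
permutation that fixes `0`. Naturality of the braiding gives
`P σ ∘ (g₁ ⊗ ⋯ ⊗ gₙ) = (σ • g) ∘ P σ` (`perm_mul_tensorPowMap`), so that
`(g, σ) ↦ (g₁ ⊗ ⋯ ⊗ gₙ) ∘ P σ` is a homomorphism on the wreath product.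

*Surjectivity.* By the hexagon identities, every braiding is a composite of braidings of two
generating objects tensored with identities. Hence every morphism is a composite of such elementary
braidings and of morphisms of `G` tensored with identities (`FreeSSMC.isGenerated`). All of these
lie in the image of the wreath product (`FreeSSMC.mem_wreathSubmonoid`).

*Injectivity.* A morphism acts on pairs of a position in its source and a label in `G`: it moves the
position and multiplies the label (`FreeSSMC.homAct`). This is compatible with all relations that
define the category (`FreeSSMC.PreHom.act_eq_of_rel`), and `(g₁ ⊗ ⋯ ⊗ gₙ) ∘ P σ` sends `(j, 1)` to
`(σ j, g_{σ j})`, from which `σ` and `g` can be read off.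
-/

/-! ### The Coxeter presentation of the symmetric group -/

section Coxeter

open Equiv Equiv.Perm

/-- The inclusion of symmetric groups that lets a permutation of `Fin n` act on the successors in
`Fin (n + 1)` and fix `0`. -/
def succPerm (n : ℕ) : Perm (Fin n) →* Perm (Fin (n + 1)) where
  toFun τ := decomposeFin.symm (0, τ)
  map_one' := by rw [decomposeFin_symm_of_one, swap_self]; rfl
  map_mul' τ τ' := by
    ext x
    refine Fin.cases ?_ (fun x => ?_) x <;> simp

@[simp]
lemma succPerm_zero {n : ℕ} (τ : Perm (Fin n)) : succPerm n τ 0 = 0 := by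
  simp [succPerm]

@[simp]
lemma succPerm_succ {n : ℕ} (τ : Perm (Fin n)) (x : Fin n) : succPerm n τ x.succ = (τ x).succ := by
  simp [succPerm]

lemma decomposeFin_symm_eq {n : ℕ} (p : Fin (n + 1)) (τ : Perm (Fin n)) :
    decomposeFin.symm (p, τ) = swap 0 p * succPerm n τ := by
  ext x
  refine Fin.cases ?_ (fun x => ?_) x <;> simp

lemma succPerm_swap {n : ℕ} (i j : Fin n) : succPerm n (swap i j) = swap i.succ j.succ := by
  ext x
  refine Fin.cases ?_ (fun x => ?_) x
  · rw [succPerm_zero, swap_apply_of_ne_of_ne (Fin.succ_ne_zero i).symm (Fin.succ_ne_zero j).symm]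
  · rw [succPerm_succ, (Fin.succ_injective n).map_swap]

lemma exists_succPerm_of_apply_zero {n : ℕ} {σ : Perm (Fin (n + 1))} (h : σ 0 = 0) :
    ∃ τ, succPerm n τ = σ := by
  obtain ⟨⟨p, τ⟩, rfl⟩ := decomposeFin.symm.surjective σ
  rw [decomposeFin_symm_apply_zero] at h
  exact ⟨τ, by rw [h]; rfl⟩

/-- The adjacent transpositions generate the symmetric group as a monoid. -/
lemma perm_induction {n : ℕ} {p : Perm (Fin n) → Prop} (one : p 1)
    (mul : ∀ σ τ, p σ → p τ → p (σ * τ))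
    (swap : ∀ (i : ℕ) (hi : i + 1 < n), p (swap ⟨i, Nat.lt_of_succ_lt hi⟩ ⟨i + 1, hi⟩))
    (σ : Perm (Fin n)) : p σ := by
  obtain _ | n := n
  · rwa [Subsingleton.elim σ 1]
  have hσ : σ ∈ Submonoid.closure
      (Set.range fun i : Fin n => Equiv.swap i.castSucc i.succ) := by
    rw [mclosure_swap_castSucc_succ]; trivial
  induction hσ using Submonoid.closure_induction with
  | mem x hx => obtain ⟨i, rfl⟩ := hx; exact swap i (by omega)
  | one => exact one
  | mul x y _ _ hx hy => exact mul x y hx hy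

variable {M : Type*} [Monoid M]

/-- A homomorphism on the permutations of `{1, …, n + 1}` extends to the permutations of
`{0, …, n + 1}` by any value `s` of the transposition `(0 1)` that satisfies the obvious
necessary relations. The image of `(0 p)` has to be the conjugate of `s` by the image of `(1 p)`,
and this determines the extension, since every permutation is `(0 p)` times one that fixes `0`. -/
lemma exists_extend_perm {n : ℕ} (Q : Perm (Fin (n + 1)) →* M) (s : M) (hs : s * s = 1)
    (hcomm : ∀ τ, τ 0 = 0 → s * Q τ = Q τ * s)
    (hbraid : ∀ j ≠ 0, s * Q (swap 0 j) * s = Q (swap 0 j) * s * Q (swap 0 j)) :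
    ∃ P : Perm (Fin (n + 2)) →* M, P (swap 0 1) = s ∧ ∀ τ, P (succPerm _ τ) = Q τ := by
  -- `t p` is going to be the image of `(0 p)`.
  let t : Fin (n + 2) → M := Fin.cases 1 fun p => Q (swap 0 p) * s * Q (swap 0 p)
  have ht0 : t 0 = 1 := rfl
  have ht (p : Fin (n + 1)) : t p.succ = Q (swap 0 p) * s * Q (swap 0 p) := rfl
  have ht1 : t 1 = s := by
    rw [← Fin.succ_zero_eq_one, ht, swap_self]
    change Q 1 * s * Q 1 = s
    simp
  have hu (p : Fin (n + 1)) : Q (swap 0 p) * Q (swap 0 p) = 1 := by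
    rw [← map_mul, swap_mul_self, map_one]
  -- `(0 τ(p)) τ (0 p)` fixes `0`, hence commutes with `s`.
  have hconj (τ : Perm (Fin (n + 1))) (p : Fin (n + 1)) :
      Q τ * t p.succ = t (τ p).succ * Q τ := by
    have h := hcomm (swap 0 (τ p) * τ * swap 0 p) (by simp)
    have h1 : Q τ * Q (swap 0 p) = Q (swap 0 (τ p)) * Q (swap 0 (τ p) * τ * swap 0 p) := by
      simp only [map_mul, ← mul_assoc, hu, one_mul]
    calc Q τ * t p.succ = Q τ * Q (swap 0 p) * s * Q (swap 0 p) := by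
          simp only [ht, mul_assoc]
      _ = Q (swap 0 (τ p)) * (s * Q (swap 0 (τ p) * τ * swap 0 p)) * Q (swap 0 p) := by
          rw [h1, h]; simp only [mul_assoc]
      _ = t (τ p).succ * Q τ := by
          simp only [ht, map_mul, mul_assoc, hu, mul_one]
  obtain ⟨P, hP⟩ : ∃ P : Perm (Fin (n + 2)) → M,
      ∀ p τ, P (swap 0 p * succPerm _ τ) = t p * Q τ :=
    ⟨fun σ => t (decomposeFin σ).1 * Q (decomposeFin σ).2, fun p τ => by
      rw [← decomposeFin_symm_eq]; simp only [Equiv.apply_symm_apply]⟩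
  have hP0 (τ : Perm (Fin (n + 1))) : P (succPerm _ τ) = Q τ := by
    have := hP 0 τ
    rwa [swap_self, ht0, one_mul, show (Equiv.refl (Fin (n + 2)) : Perm _) = 1 from rfl,
      one_mul] at this
  have hP1 : P 1 = 1 := by rw [← map_one (succPerm (n + 1)), hP0, map_one]
  -- It is enough to multiply on the left by a permutation that fixes `0` or by `(0 1)`.
  have hsucc (τ : Perm (Fin (n + 1))) (σ : Perm (Fin (n + 2))) :
      P (succPerm _ τ * σ) = Q τ * P σ := by
    obtain ⟨⟨p, e⟩, rfl⟩ := decomposeFin.symm.surjective σ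
    have h : succPerm _ τ * swap 0 p = swap 0 (succPerm _ τ p) * succPerm _ τ := by
      have := mul_swap_eq_swap_mul (succPerm _ τ) 0 p
      rwa [succPerm_zero] at this
    rw [decomposeFin_symm_eq, ← mul_assoc, h, mul_assoc, ← map_mul, hP, hP]
    refine Fin.cases ?_ (fun p => ?_) p
    · rw [succPerm_zero, ht0, one_mul, one_mul, map_mul]
    · rw [succPerm_succ, map_mul, ← mul_assoc, ← mul_assoc, hconj]
  have hzero (σ : Perm (Fin (n + 2))) : P (swap 0 1 * σ) = s * P σ := by
    obtain ⟨⟨p, e⟩, rfl⟩ := decomposeFin.symm.surjective σ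
    rw [decomposeFin_symm_eq, hP]
    refine Fin.cases ?_ (fun p => ?_) p
    · rw [swap_self, show (Equiv.refl (Fin (n + 2)) : Perm _) = 1 from rfl, one_mul, hP, ht1, ht0,
        one_mul]
    · by_cases hp : p = 0
      · rw [hp, Fin.succ_zero_eq_one, ← mul_assoc, swap_mul_self, one_mul, ht1, hP0, ← mul_assoc,
          hs, one_mul]
      · -- `(0 1) (0 q) = (0 q) (1 q)` for `q ≠ 0, 1`
        have h : swap (0 : Fin (n + 2)) 1 * swap 0 p.succ =
            swap 0 p.succ * succPerm _ (swap 0 p) := by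
          have := mul_swap_eq_swap_mul (swap (0 : Fin (n + 2)) p.succ) 1 p.succ
          rw [swap_apply_right, swap_apply_of_ne_of_ne (by simp)
            (by rw [← Fin.succ_zero_eq_one]; exact fun h => hp (Fin.succ_injective _ h).symm),
            swap_comm 1 0] at this
          rw [succPerm_swap, Fin.succ_zero_eq_one, this]
        rw [← mul_assoc, h, mul_assoc, ← map_mul, hP, map_mul, ← mul_assoc, ← mul_assoc, ht]
        congr 1
        rw [mul_assoc _ _ (Q (swap 0 p)), hu, mul_one, ← mul_assoc, ← mul_assoc, hbraid p hp,
          mul_assoc _ _ (Q (swap 0 p)), hu, mul_one]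
  refine ⟨⟨⟨P, hP1⟩, fun σ ρ => ?_⟩, ?_, hP0⟩
  · change P (σ * ρ) = P σ * P ρ
    induction σ using perm_induction generalizing ρ with
    | one => rw [one_mul, hP1, one_mul]
    | mul σ τ hσ hτ => rw [mul_assoc, hσ, hτ, hσ, mul_assoc (P σ)]
    | swap i hi =>
      obtain _ | i := i
      · have h := hzero 1
        rw [mul_one, hP1, mul_one] at h
        exact (hzero ρ).trans (congrArg (· * P ρ) h.symm)
      · have h := succPerm_swap (n := n + 1) ⟨i, by omega⟩ ⟨i + 1, by omega⟩
        simp only [Fin.succ_mk] at h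
        rw [← h, hsucc, hP0]
  · change P (swap 0 1) = s
    have h := hzero 1
    rwa [mul_one, hP1, mul_one] at h

/-- The Coxeter presentation of the symmetric group: elements of a monoid that satisfy the
relations of the adjacent transpositions define a homomorphism. -/
theorem exists_perm_hom_of_coxeter (n : ℕ) (s : ℕ → M)
    (sq : ∀ i, i + 1 < n → s i * s i = 1)
    (braid : ∀ i, i + 2 < n → s i * s (i + 1) * s i = s (i + 1) * s i * s (i + 1))
    (comm : ∀ i j, i + 2 ≤ j → j + 1 < n → s i * s j = s j * s i) :
    ∃ P : Perm (Fin n) →* M, ∀ (i : ℕ) (hi : i + 1 < n),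
      P (swap ⟨i, Nat.lt_of_succ_lt hi⟩ ⟨i + 1, hi⟩) = s i := by
  induction n generalizing s with
  | zero => exact ⟨1, fun i hi => absurd hi (by omega)⟩
  | succ n ih =>
    obtain _ | n := n
    · exact ⟨1, fun i hi => absurd hi (by omega)⟩
    obtain ⟨Q, hQ⟩ := ih (fun i => s (i + 1)) (fun i hi => sq _ (by omega))
      (fun i hi => braid _ (by omega)) (fun i j hij hj => comm _ _ (by omega) (by omega))
    have hcomm (τ : Perm (Fin (n + 1))) (hτ : τ 0 = 0) : s 0 * Q τ = Q τ * s 0 := by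
      obtain ⟨τ, rfl⟩ := exists_succPerm_of_apply_zero hτ
      clear hτ
      induction τ using perm_induction with
      | one => simp
      | mul σ τ hσ hτ => rw [map_mul, map_mul, ← mul_assoc, hσ, mul_assoc, hτ, mul_assoc]
      | swap i hi =>
        rw [succPerm_swap]
        simp only [Fin.succ_mk]
        rw [hQ (i + 1) (by omega)]
        exact comm 0 (i + 2) (by omega) (by omega)
    have hbraid (j : Fin (n + 1)) (hj : j ≠ 0) :
        s 0 * Q (swap 0 j) * s 0 = Q (swap 0 j) * s 0 * Q (swap 0 j) := by
      obtain _ | n := n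
      · exact absurd (Fin.fin_one_eq_zero j) hj
      -- `(0 j)` is the conjugate of `(0 1)` by `(1 j)`, whose image commutes with `s 0`.
      have hc := hcomm (swap 1 j) (swap_apply_of_ne_of_ne (by simp) hj.symm)
      have hcc : Q (swap 1 j) * Q (swap 1 j) = 1 := by
        rw [← map_mul, swap_mul_self, map_one]
      have hq : Q (swap 0 1) = s 1 := hQ 0 (by omega)
      have hconj : Q (swap 0 j) = Q (swap 1 j) * s 1 * Q (swap 1 j) := by
        rw [← hq, ← map_mul, ← map_mul, mul_swap_eq_swap_mul (swap 1 j),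
          swap_apply_of_ne_of_ne (by simp) hj.symm, swap_apply_left, mul_assoc, swap_mul_self,
          mul_one]
      rw [hconj]
      generalize Q (swap 1 j) = c at hc hcc
      calc s 0 * (c * s 1 * c) * s 0 = (s 0 * c) * s 1 * (c * s 0) := by simp only [mul_assoc]
        _ = c * (s 0 * s 1 * s 0) * c := by rw [hc, ← hc]; simp only [mul_assoc, hc]
        _ = c * s 1 * (s 0 * s 1) * c := by rw [braid 0 (by omega)]; simp only [mul_assoc]
        _ = c * s 1 * (s 0 * (c * c) * s 1) * c := by rw [hcc, mul_one]
        _ = c * s 1 * ((s 0 * c) * c * s 1) * c := by simp only [mul_assoc]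
        _ = c * s 1 * c * s 0 * (c * s 1 * c) := by rw [hc]; simp only [mul_assoc]
    obtain ⟨P, hP0, hP⟩ := exists_extend_perm Q (s 0) (sq 0 (by omega)) hcomm hbraid
    refine ⟨P, fun i hi => ?_⟩
    obtain _ | i := i
    · exact hP0
    · have h := succPerm_swap (n := n + 1) ⟨i, by omega⟩ ⟨i + 1, by omega⟩
      simp only [Fin.succ_mk] at h
      rw [← h, hP, hQ i (by omega)]

end Coxeter

/-! ### Relations between endomorphisms of a tensor power -/

section PowerRelations

variable {C : Type u} [Category.{v} C] [MonoidalCategory C]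

/-- The homomorphism `End X →* End (A ⊗ X)` sending `f` to `id ⊗ f`. -/
def whiskerEnd (A X : C) : End X →* End (A ⊗ X) where
  toFun f := A ◁ f.asHom
  map_one' := MonoidalCategory.whiskerLeft_id A X
  map_mul' f g := MonoidalCategory.whiskerLeft_comp A g.asHom f.asHom

/-- The endomorphism `a ⊗ f` of `A ⊗ X`. -/
def tensorEnd {A X : C} (a : End A) (f : End X) : End (A ⊗ X) := a.asHom ⊗ₘ f.asHom

lemma tensorEnd_mul {A X : C} (a b : End A) (f g : End X) :
    tensorEnd (a * b) (f * g) = tensorEnd a f * tensorEnd b g :=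
  (tensorHom_comp_tensorHom b.asHom g.asHom a.asHom f.asHom).symm

lemma tensorEnd_one_one (A X : C) : tensorEnd (1 : End A) (1 : End X) = 1 :=
  id_tensorHom_id A X

lemma whiskerEnd_apply {A X : C} (f : End X) : whiskerEnd A X f = tensorEnd 1 f :=
  (id_tensorHom A f.asHom).symm

lemma tensorPowMap_succ {A : C} (n : ℕ) (g : Fin (n + 1) → End A) :
    tensorPowMap (n + 1) g = tensorEnd (g 0) (tensorPowMap n fun i => g i.succ) := rfl

/-- The tensor product of `n` endomorphisms of `A`, as a homomorphism. -/
def tensorPowHom (A : C) (n : ℕ) : (Fin n → End A) →* End (tensorPow A n) where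
  toFun := tensorPowMap n
  map_one' := by
    induction n with
    | zero => rfl
    | succ n ih => exact (congrArg (tensorEnd 1) ih).trans (tensorEnd_one_one _ _)
  map_mul' g h := by
    induction n with
    | zero => exact (Category.id_comp _).symm
    | succ n ih => exact (congrArg (tensorEnd _) (ih _ _)).trans (tensorEnd_mul _ _ _ _)

variable [SymmetricCategory C]

/-- The braiding of the two left-most factors of `A ⊗ A ⊗ X`. -/
def frontBraiding (A X : C) : End (A ⊗ A ⊗ X) :=
  (α_ A A X).inv ≫ (β_ A A).hom ▷ X ≫ (α_ A A X).hom

lemma frontBraiding_mul_self (A X : C) : frontBraiding A X * frontBraiding A X = 1 := by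
  simp [End.mul_def, frontBraiding, ← comp_whiskerRight_assoc]

lemma frontBraiding_mul_whiskerEnd (A X : C) (f : End X) :
    frontBraiding A X * whiskerEnd A _ (whiskerEnd A X f) =
      whiskerEnd A _ (whiskerEnd A X f) * frontBraiding A X := by
  change A ◁ A ◁ f.asHom ≫ (α_ A A X).inv ≫ (β_ A A).hom ▷ X ≫ (α_ A A X).hom =
    ((α_ A A X).inv ≫ (β_ A A).hom ▷ X ≫ (α_ A A X).hom) ≫ A ◁ A ◁ f.asHom
  simp only [Category.assoc, associator_inv_naturality_right_assoc, whisker_exchange_assoc,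
    associator_naturality_right]

lemma frontBraiding_mul_tensorEnd (A X : C) (a b : End A) (f : End X) :
    frontBraiding A X * tensorEnd a (tensorEnd b f) =
      tensorEnd b (tensorEnd a f) * frontBraiding A X := by
  generalize ha : a.asHom = a'
  generalize hb : b.asHom = b'
  generalize hf : f.asHom = f'
  change (a.asHom ⊗ₘ (b.asHom ⊗ₘ f.asHom)) ≫ (α_ A A X).inv ≫ (β_ A A).hom ▷ X ≫ (α_ A A X).hom =
    ((α_ A A X).inv ≫ (β_ A A).hom ▷ X ≫ (α_ A A X).hom) ≫ (b.asHom ⊗ₘ (a.asHom ⊗ₘ f.asHom))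
  rw [ha, hb, hf]
  have h := BraidedCategory.braiding_naturality a' b'
  rw [associator_inv_naturality_assoc, ← tensorHom_id, Category.assoc, Category.assoc,
    ← associator_naturality, tensorHom_comp_tensorHom_assoc, tensorHom_comp_tensorHom_assoc, h,
    Category.comp_id, Category.id_comp]

/-- The Yang–Baxter equation for the braiding of `A` with itself, tensored with `X`. -/
lemma frontBraiding_braid (A X : C) :
    frontBraiding A (A ⊗ X) * whiskerEnd A _ (frontBraiding A X) * frontBraiding A (A ⊗ X) =
      whiskerEnd A _ (frontBraiding A X) * frontBraiding A (A ⊗ X) *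
        whiskerEnd A _ (frontBraiding A X) := by
  have h := congrArg (fun f => (α_ A A (A ⊗ X)).inv ≫ (α_ (A ⊗ A) A X).inv ≫
    (α_ A A A).hom ▷ X ≫ f ▷ X ≫ (α_ A (A ⊗ A) X).hom ≫ A ◁ (α_ A A X).hom)
    (BraidedCategory.yang_baxter A A A)
  change ((α_ A A (A ⊗ X)).inv ≫ (β_ A A).hom ▷ (A ⊗ X) ≫ (α_ A A (A ⊗ X)).hom) ≫
      A ◁ ((α_ A A X).inv ≫ (β_ A A).hom ▷ X ≫ (α_ A A X).hom) ≫
      ((α_ A A (A ⊗ X)).inv ≫ (β_ A A).hom ▷ (A ⊗ X) ≫ (α_ A A (A ⊗ X)).hom) =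
    A ◁ ((α_ A A X).inv ≫ (β_ A A).hom ▷ X ≫ (α_ A A X).hom) ≫
      ((α_ A A (A ⊗ X)).inv ≫ (β_ A A).hom ▷ (A ⊗ X) ≫ (α_ A A (A ⊗ X)).hom) ≫
      A ◁ ((α_ A A X).inv ≫ (β_ A A).hom ▷ X ≫ (α_ A A X).hom)
  refine Eq.trans ?_ (h.trans ?_) <;> monoidal

variable (A : C)

lemma elementaryBraiding_mul_self (n i : ℕ) :
    elementaryBraiding A n i * elementaryBraiding A n i = 1 := by
  induction n generalizing i with
  | zero => exact mul_one _
  | succ n ih =>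
    obtain _ | n := n
    · exact mul_one _
    obtain _ | i := i
    · exact frontBraiding_mul_self A _
    · have := congrArg (whiskerEnd A _) (ih i)
      rw [map_mul, map_one] at this
      exact this

lemma elementaryBraiding_comm (n i j : ℕ) (hij : i + 2 ≤ j) (hj : j + 1 < n) :
    elementaryBraiding A n i * elementaryBraiding A n j =
      elementaryBraiding A n j * elementaryBraiding A n i := by
  induction n generalizing i j with
  | zero => omega
  | succ n ih =>
    obtain _ | n := n
    · omega
    obtain _ | j := j
    · omega
    obtain _ | i := i
    · obtain _ | j := j
      · omega
      obtain _ | n := n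
      · omega
      exact frontBraiding_mul_whiskerEnd A (tensorPow A (n + 1)) (elementaryBraiding A (n + 1) j)
    · have := congrArg (whiskerEnd A _) (ih i j (by omega) (by omega))
      rw [map_mul, map_mul] at this
      exact this

lemma elementaryBraiding_braid (n i : ℕ) (hi : i + 2 < n) :
    elementaryBraiding A n i * elementaryBraiding A n (i + 1) * elementaryBraiding A n i =
      elementaryBraiding A n (i + 1) * elementaryBraiding A n i *
        elementaryBraiding A n (i + 1) := by
  induction n generalizing i with
  | zero => omega
  | succ n ih =>
    obtain _ | n := n
    · omega
    obtain _ | i := i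
    · obtain _ | n := n
      · omega
      exact frontBraiding_braid A (tensorPow A n)
    · have := congrArg (whiskerEnd A _) (ih i (by omega))
      simp only [map_mul] at this
      exact this

lemma elementaryBraiding_mul_tensorPowMap (n i : ℕ) (hi : i + 1 < n) (g : Fin n → End A) :
    elementaryBraiding A n i * tensorPowMap n g =
      tensorPowMap n (fun j => g (Equiv.swap ⟨i, Nat.lt_of_succ_lt hi⟩ ⟨i + 1, hi⟩ j)) *
        elementaryBraiding A n i := by
  induction n generalizing i with
  | zero => omega
  | succ n ih =>
    obtain _ | n := n
    · omega
    obtain _ | i := i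
    · have hfix (j : Fin n) :
          Equiv.swap (⟨0, Nat.lt_of_succ_lt hi⟩ : Fin (n + 2)) ⟨1, hi⟩ j.succ.succ =
            j.succ.succ :=
        Equiv.swap_apply_of_ne_of_ne (by simp [Fin.ext_iff]) (by simp [Fin.ext_iff])
      have h1 : Equiv.swap (⟨0, Nat.lt_of_succ_lt hi⟩ : Fin (n + 2)) ⟨1, hi⟩ (Fin.succ 0) = 0 :=
        Equiv.swap_apply_right _ _
      have h0 : Equiv.swap (⟨0, Nat.lt_of_succ_lt hi⟩ : Fin (n + 2)) ⟨1, hi⟩ 0 = Fin.succ 0 :=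
        Equiv.swap_apply_left _ _
      have := frontBraiding_mul_tensorEnd A _ (g 0) (g (Fin.succ 0))
        (tensorPowMap n fun i => g i.succ.succ)
      simp only [tensorPowMap_succ, hfix, h0, h1, zero_add]
      exact this
    · have hswap : Equiv.swap (⟨i + 1, Nat.lt_of_succ_lt hi⟩ : Fin (n + 2)) ⟨i + 1 + 1, hi⟩ =
          succPerm _ (Equiv.swap ⟨i, by omega⟩ ⟨i + 1, by omega⟩) := by
        rw [succPerm_swap]; rfl
      have h : whiskerEnd A _ (elementaryBraiding A (n + 1) i) *
            tensorEnd (g 0) (tensorPowMap (n + 1) fun j => g j.succ) =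
          tensorEnd (g 0) (tensorPowMap (n + 1) fun j =>
              g (Equiv.swap ⟨i, by omega⟩ ⟨i + 1, by omega⟩ j).succ) *
            whiskerEnd A _ (elementaryBraiding A (n + 1) i) := by
        rw [whiskerEnd_apply, ← tensorEnd_mul, ← tensorEnd_mul, one_mul, mul_one, ih i (by omega)]
      refine h.trans (congrArg (· * _) (Eq.symm ?_))
      refine (tensorPowMap_succ _ _).trans ?_
      simp only [hswap, succPerm_zero, succPerm_succ]
      rfl

end PowerRelations

namespace FreeSSMC

/-! ### Generation of the morphisms by elementary ones -/

section Generation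

lemma strict_leftUnitor_inv {D : Type u₁} [Category.{v₁} D] [MonoidalCategory D]
    [IsStrictMonoidal D] (X : D) :
    (λ_ X).inv = eqToHom (IsStrictMonoidal.unit_tensor X).symm := by
  rw [← cancel_epi (λ_ X).hom, Iso.hom_inv_id, IsStrictMonoidal.leftUnitor_eq]; simp

lemma strict_rightUnitor_inv {D : Type u₁} [Category.{v₁} D] [MonoidalCategory D]
    [IsStrictMonoidal D] (X : D) :
    (ρ_ X).inv = eqToHom (IsStrictMonoidal.tensor_unit X).symm := by
  rw [← cancel_epi (ρ_ X).hom, Iso.hom_inv_id, IsStrictMonoidal.rightUnitor_eq]; simp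

variable {B : Type u} [Category.{v} B]

/-- The morphisms obtained from those of `B` and the braidings of two objects of `B` by tensoring
with identities and composing. Tensoring on the right is allowed for the generators only, tensoring
on the left one generating object at a time: this is the form in which elementary braidings of
tensor powers are defined. -/
inductive IsGenerated : ∀ {X Y : FreeSSMC B}, (X ⟶ Y) → Prop
  | id (X : FreeSSMC B) : IsGenerated (𝟙 X)
  | comp {X Y Z : FreeSSMC B} {f : X ⟶ Y} {g : Y ⟶ Z} :
      IsGenerated f → IsGenerated g → IsGenerated (f ≫ g)
  | whiskerLeft (a : B) {X Y : FreeSSMC B} {f : X ⟶ Y} :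
      IsGenerated f → IsGenerated ((incl B).obj a ◁ f)
  | of {a b : B} (f : a ⟶ b) (X : FreeSSMC B) : IsGenerated ((incl B).map f ▷ X)
  | braid (a b : B) (X : FreeSSMC B) :
      IsGenerated ((β_ ((incl B).obj a) ((incl B).obj b)).hom ▷ X)

namespace IsGenerated

lemma of_eqToHom {X Y : FreeSSMC B} (h : X = Y) : IsGenerated (eqToHom h) := by
  subst h; exact .id X

lemma associator_hom (X Y Z : FreeSSMC B) : IsGenerated (α_ X Y Z).hom := by
  rw [IsStrictMonoidal.associator_eq]; exact .of_eqToHom _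

lemma associator_inv (X Y Z : FreeSSMC B) : IsGenerated (α_ X Y Z).inv := by
  rw [strict_assoc_inv]; exact .of_eqToHom _

lemma associator_hom_whiskerRight (W X Y Z : FreeSSMC B) :
    IsGenerated ((α_ X Y Z).hom ▷ W) := by
  rw [IsStrictMonoidal.associator_eq, eqToHom_whiskerRight]; exact .of_eqToHom _

lemma associator_inv_whiskerRight (W X Y Z : FreeSSMC B) :
    IsGenerated ((α_ X Y Z).inv ▷ W) := by
  rw [strict_assoc_inv, eqToHom_whiskerRight]; exact .of_eqToHom _

lemma leftUnitor_hom (X : FreeSSMC B) : IsGenerated (λ_ X).hom := by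
  rw [IsStrictMonoidal.leftUnitor_eq]; exact .of_eqToHom _

lemma leftUnitor_inv (X : FreeSSMC B) : IsGenerated (λ_ X).inv := by
  rw [strict_leftUnitor_inv]; exact .of_eqToHom _

lemma rightUnitor_hom (X : FreeSSMC B) : IsGenerated (ρ_ X).hom := by
  rw [IsStrictMonoidal.rightUnitor_eq]; exact .of_eqToHom _

lemma rightUnitor_inv (X : FreeSSMC B) : IsGenerated (ρ_ X).inv := by
  rw [strict_rightUnitor_inv]; exact .of_eqToHom _

lemma whiskerLeft_obj (X : FreeSSMC B) {Y Z : FreeSSMC B} {f : Y ⟶ Z} (hf : IsGenerated f) :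
    IsGenerated (X ◁ f) := by
  induction X with
  | nil =>
    change IsGenerated (𝟙_ (FreeSSMC B) ◁ f)
    rw [id_whiskerLeft]
    exact (leftUnitor_hom _).comp (hf.comp (leftUnitor_inv _))
  | cons a X ih =>
    change IsGenerated (((incl B).obj a ⊗ (show FreeSSMC B from X)) ◁ f)
    rw [tensor_whiskerLeft]
    exact (associator_hom _ _ _).comp ((ih.whiskerLeft a).comp (associator_inv _ _ _))

/-- By the hexagon identity, moving one object past a word is moving it past the letters one by one.
The factor `X` on the right is needed because right whiskering is not one of the generating
operations. -/
lemma braiding_singleton_whiskerRight (a : B) (X Y : FreeSSMC B) :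
    IsGenerated ((β_ ((incl B).obj a) Y).hom ▷ X) := by
  induction Y with
  | nil =>
    change IsGenerated ((β_ ((incl B).obj a) (𝟙_ (FreeSSMC B))).hom ▷ X)
    rw [braiding_tensorUnit_right, IsStrictMonoidal.rightUnitor_eq, strict_leftUnitor_inv,
      eqToHom_trans, eqToHom_whiskerRight]
    exact .of_eqToHom _
  | cons b Y ih =>
    change IsGenerated
      ((β_ ((incl B).obj a) ((incl B).obj b ⊗ (show FreeSSMC B from Y))).hom ▷ X)
    generalize (show FreeSSMC B from Y) = Y at ih ⊢
    have h : (β_ ((incl B).obj a) ((incl B).obj b ⊗ Y)).hom ▷ X =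
        (α_ _ _ _).inv ▷ X ≫ (α_ _ _ _).hom ≫
          (β_ ((incl B).obj a) ((incl B).obj b)).hom ▷ (Y ⊗ X) ≫ (α_ _ _ _).inv ≫
          (α_ _ _ _).hom ▷ X ≫ (α_ _ _ _).hom ≫
          (incl B).obj b ◁ ((β_ ((incl B).obj a) Y).hom ▷ X) ≫ (α_ _ _ _).inv ≫
          (α_ _ _ _).inv ▷ X := by
      simp
    rw [h]
    exact (associator_inv_whiskerRight _ _ _ _).comp <| (associator_hom _ _ _).comp <|
      (braid a b _).comp <| (associator_inv _ _ _).comp <|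
      (associator_hom_whiskerRight _ _ _ _).comp <| (associator_hom _ _ _).comp <|
      (ih.whiskerLeft b).comp <| (associator_inv _ _ _).comp <|
      associator_inv_whiskerRight _ _ _ _

lemma braiding_hom (X Y : FreeSSMC B) : IsGenerated (β_ X Y).hom := by
  induction X with
  | nil =>
    change IsGenerated (β_ (𝟙_ (FreeSSMC B)) Y).hom
    rw [braiding_tensorUnit_left]
    exact (leftUnitor_hom _).comp (rightUnitor_inv _)
  | cons a X ih =>
    change IsGenerated (β_ ((incl B).obj a ⊗ (show FreeSSMC B from X)) Y).hom
    rw [BraidedCategory.braiding_tensor_left_hom]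
    exact (associator_hom _ _ _).comp ((ih.whiskerLeft a).comp ((associator_inv _ _ _).comp
      ((braiding_singleton_whiskerRight a _ _).comp (associator_hom _ _ _))))

lemma tensorHom {X Y X' Y' : FreeSSMC B} {f : X ⟶ Y} {g : X' ⟶ Y'} (hf : IsGenerated f)
    (hg : IsGenerated g) : IsGenerated (f ⊗ₘ g) := by
  -- Conjugation by braidings turns right whiskering into left whiskering.
  have h : f ⊗ₘ g = (β_ X X').hom ≫ X' ◁ f ≫ (β_ X' Y).hom ≫ Y ◁ g := by
    rw [MonoidalCategory.tensorHom_def, ← BraidedCategory.braiding_naturality_left_assoc]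
    simp
  rw [h]
  exact (braiding_hom _ _).comp ((hf.whiskerLeft_obj X').comp
    ((braiding_hom _ _).comp (hg.whiskerLeft_obj Y)))

lemma incl_map {a b : B} (f : a ⟶ b) : IsGenerated ((incl B).map f) := by
  have h : (incl B).map f = (ρ_ _).inv ≫ (incl B).map f ▷ 𝟙_ (FreeSSMC B) ≫ (ρ_ _).hom := by
    rw [rightUnitor_naturality, Iso.inv_hom_id_assoc]
  rw [h]
  exact (rightUnitor_inv _).comp ((IsGenerated.of f _).comp (rightUnitor_hom _))

lemma of_homMk {X Y : List B} (f : PreHom X Y) : IsGenerated (homMk f) := by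
  induction f with
  | of f => exact incl_map f
  | eqTo h => rw [homMk_eqTo]; exact .of_eqToHom h
  | comp f g hf hg => exact hf.comp hg
  | tensor f g hf hg => exact hf.tensorHom hg
  | braid X Y => exact braiding_hom X Y

end IsGenerated

/-- All morphisms of the free strict symmetric monoidal category are composites of morphisms of `B`
and braidings of two generating objects, tensored with identities. -/
theorem isGenerated {X Y : FreeSSMC B} (f : X ⟶ Y) : IsGenerated f := by
  obtain ⟨f⟩ := f
  exact IsGenerated.of_homMk f

end Generation

/-! ### The action of morphisms on positions and labels -/

section Action

variable {G : Type w} [Group G]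

/-- The block sum of two self-maps of `ℕ × G`: `f` acts on the positions below `m`, and `g` on the
positions from `m` on, shifted to start at `0`. -/
def blockSum (m : ℕ) (f g : ℕ × G → ℕ × G) (p : ℕ × G) : ℕ × G :=
  if p.1 < m then f p else ((g (p.1 - m, p.2)).1 + m, (g (p.1 - m, p.2)).2)

/-- A self-map of `ℕ × G` that preserves the set of the positions below `m` and is the identity at
the other positions. -/
def SupportedBelow (m : ℕ) (f : ℕ × G → ℕ × G) : Prop :=
  ∀ i x, (i < m → (f (i, x)).1 < m) ∧ (m ≤ i → f (i, x) = (i, x))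

/-- The action of a formal morphism on pairs of a position in its source and a label in `G`: the
position is carried to a position in the target, and the label is multiplied by the elements of `G`
met on the way. Positions that exceed the length of the source are fixed; acting on all of `ℕ`
avoids transport along equalities of words. -/
def PreHom.act : ∀ {X Y : List (SingleObj G)}, PreHom X Y → ℕ × G → ℕ × G
  | _, _, .of f => fun p => (p.1, if p.1 = 0 then (show G from f) * p.2 else p.2)
  | _, _, .eqTo _ => fun p => p
  | _, _, .comp f g => g.act ∘ f.act
  | _, _, .tensor (X := X) f g => blockSum X.length f.act g.act
  | _, _, .braid X Y => fun p =>
      (if p.1 < X.length then p.1 + Y.length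
        else if p.1 < X.length + Y.length then p.1 - X.length else p.1, p.2)

/-- Morphisms of the one-object category do not change the number of factors. -/
lemma PreHom.length_eq {X Y : List (SingleObj G)} (f : PreHom X Y) : X.length = Y.length := by
  induction f with
  | of f => rfl
  | eqTo h => rw [h]
  | comp f g hf hg => exact hf.trans hg
  | tensor f g hf hg => rw [List.length_append, List.length_append, hf, hg]
  | braid X Y => rw [List.length_append, List.length_append, add_comm]

lemma PreHom.supportedBelow_act {X Y : List (SingleObj G)} (f : PreHom X Y) :
    SupportedBelow X.length f.act := by
  induction f with
  | of f =>
    refine fun i x => ⟨fun h => h, fun h => ?_⟩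
    rw [List.length_singleton] at h
    simp only [act, if_neg (show ¬ i = 0 by omega)]
  | eqTo h => exact fun i x => ⟨fun h => h, fun _ => rfl⟩
  | comp f g hf hg =>
    rw [← f.length_eq] at hg
    refine fun i x => ⟨fun h => ?_, fun h => ?_⟩
    · exact (hg _ _).1 ((hf i x).1 h)
    · simp only [act, Function.comp_apply, (hf i x).2 h, (hg i x).2 h]
  | @tensor X Y X' Y' f g hf hg =>
    intro i x
    simp only [act, List.length_append, blockSum]
    have h1 := hf i x
    have h2 := hg (i - X.length) x
    refine ⟨fun h => ?_, fun h => ?_⟩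
    · split_ifs with hi
      · have := h1.1 hi; omega
      · have := h2.1 (by omega)
        dsimp only; omega
    · rw [if_neg (by omega), h2.2 (by omega)]
      ext
      · dsimp only; omega
      · rfl
  | braid X Y =>
    intro i x
    simp only [act, List.length_append, Prod.mk.injEq, and_true]
    split_ifs <;> omega

/-- The action respects the congruence that defines the free strict symmetric monoidal category. -/
lemma PreHom.act_eq_of_rel {X Y : List (SingleObj G)} {f g : PreHom X Y} (h : Rel f g) :
    f.act = g.act := by
  induction h with
  | refl => rfl
  | symm _ ih => exact ih.symm
  | trans _ _ ih ih' => exact ih.trans ih'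
  | comp_congr _ _ ih ih' => simp only [act, ih, ih']
  | tensor_congr _ _ ih ih' => simp only [act, ih, ih']
  | of_id X =>
    funext ⟨i, x⟩
    refine Prod.ext rfl ?_
    change (if i = 0 then (1 : G) * x else x) = x
    rw [one_mul, ite_self]
  | @of_comp X Y Z f g =>
    funext ⟨i, x⟩
    refine Prod.ext rfl ?_
    change (if i = 0 then ((show G from g) * (show G from f)) * x else x) =
      if i = 0 then (show G from g) * (if i = 0 then (show G from f) * x else x)
        else if i = 0 then (show G from f) * x else x
    split_ifs
    · rw [mul_assoc]
    · rfl
  | id_comp => rfl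
  | comp_id => rfl
  | assoc => rfl
  | id_tensor_id X Y =>
    funext ⟨i, x⟩
    simp only [act, blockSum]
    split_ifs with h
    · rfl
    · rw [Nat.sub_add_cancel (by omega)]
  | @tensor_comp_tensor X Y Z X' Y' Z' f g f' g' =>
    funext ⟨i, x⟩
    have h1 := f.supportedBelow_act i x
    simp only [act, blockSum, Function.comp_apply, ← f.length_eq]
    by_cases h : i < X.length
    · simp only [h, h1.1 h, if_true]
    · simp [h]
  | @tensor_assoc X Y X' Y' X'' Y'' f f' f'' =>
    funext ⟨i, x⟩
    simp only [act, blockSum, Function.comp_apply, List.length_append]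
    by_cases h : i < X.length
    · simp only [h, if_true, show i < X.length + X'.length by omega]
    · by_cases h' : i < X.length + X'.length
      · simp only [h, h', if_true, if_false, show i - X.length < X'.length by omega]
      · simp only [h, h', if_false, show ¬ i - X.length < X'.length by omega, Nat.sub_sub]
        ext
        · dsimp only; omega
        · rfl
  | unit_tensor f =>
    funext ⟨i, x⟩
    simp [act, blockSum]
  | tensor_unit f =>
    funext ⟨i, x⟩
    have h1 := f.supportedBelow_act i x
    simp only [act, blockSum, Function.comp_apply]
    split_ifs with h
    · rfl
    · rw [h1.2 (by omega), Nat.sub_add_cancel (by omega)]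
  | @braid_naturality X Y X' Y' f f' =>
    funext ⟨i, x⟩
    have h1 := f.supportedBelow_act i x
    have h2 := f'.supportedBelow_act (i - X.length) x
    simp only [act, blockSum, Function.comp_apply, ← f.length_eq, ← f'.length_eq]
    by_cases h : i < X.length
    · have := h1.1 h
      simp [h, this]
    · by_cases h' : i < X.length + X'.length
      · have := h2.1 (by omega)
        simp only [h, h', if_true, if_false, show i - X.length < X'.length by omega]
        ext
        · dsimp only; split_ifs <;> omega
        · rfl
      · have := h2.2 (by omega)
        have h3 := f.supportedBelow_act (i - X'.length) x
        rw [if_neg h, this]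
        simp only [h, h', if_false, show ¬ i < X'.length by omega]
        rw [h3.2 (by omega)]
        ext
        · dsimp only; split_ifs <;> omega
        · rfl
  | hexagon_forward X Y Z =>
    funext ⟨i, x⟩
    simp only [act, blockSum, Function.comp_apply, List.length_append]
    split_ifs <;> refine Prod.ext ?_ rfl <;> dsimp only at * <;> omega
  | hexagon_reverse X Y Z =>
    funext ⟨i, x⟩
    simp only [act, blockSum, Function.comp_apply, List.length_append]
    split_ifs <;> refine Prod.ext ?_ rfl <;> dsimp only at * <;> omega
  | symmetry X Y =>
    funext ⟨i, x⟩
    simp only [act, Function.comp_apply, Prod.mk.injEq, and_true]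
    split_ifs <;> omega

end Action

section WreathAction

variable {G : Type w} [Group G]

/-- The action of a morphism on pairs of a position and a label. -/
def homAct {X Y : FreeSSMC (SingleObj G)} (f : X ⟶ Y) : ℕ × G → ℕ × G :=
  Quotient.lift PreHom.act (fun _ _ h => PreHom.act_eq_of_rel h) f

lemma homAct_comp {X Y Z : FreeSSMC (SingleObj G)} (f : X ⟶ Y) (g : Y ⟶ Z) :
    homAct (f ≫ g) = homAct g ∘ homAct f := by
  obtain ⟨f⟩ := f
  obtain ⟨g⟩ := g
  rfl

lemma homAct_tensorHom {X Y X' Y' : FreeSSMC (SingleObj G)} (f : X ⟶ Y) (g : X' ⟶ Y') :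
    homAct (f ⊗ₘ g) = blockSum (List.length X) (homAct f) (homAct g) := by
  obtain ⟨f⟩ := f
  obtain ⟨g⟩ := g
  rfl

lemma homAct_tensorPowMap (n : ℕ) (g : Fin n → G) (i : Fin n) (x : G) :
    homAct (tensorPowMap n fun i => genEnd (g i)).asHom (i, x) = ((i : ℕ), g i * x) := by
  induction n with
  | zero => exact i.elim0
  | succ n ih =>
    change homAct ((genEnd (g 0)).asHom ⊗ₘ
      (tensorPowMap n fun i => genEnd (g i.succ)).asHom) (i, x) = _
    rw [homAct_tensorHom]
    induction i using Fin.cases with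
    | zero => rfl
    | succ i =>
      have h := ih (fun i => g i.succ) i
      change (if (i : ℕ) + 1 < 1 then _ else _) = _
      rw [if_neg (by omega)]
      dsimp only [Fin.val_succ]
      change ((homAct (tensorPowMap n fun i => genEnd (g i.succ)).asHom ((i : ℕ), x)).1 + 1,
        (homAct (tensorPowMap n fun i => genEnd (g i.succ)).asHom ((i : ℕ), x)).2) = _
      rw [h]

lemma homAct_elementaryBraiding (n i : ℕ) (hi : i + 1 < n) (j : Fin n) (x : G) :
    homAct (elementaryBraiding (genObj G) n i).asHom (j, x) =
      (((Equiv.swap ⟨i, Nat.lt_of_succ_lt hi⟩ ⟨i + 1, hi⟩ j : Fin n) : ℕ), x) := by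
  induction n generalizing i with
  | zero => omega
  | succ n ih =>
    obtain _ | n := n
    · omega
    obtain _ | i := i
    · change homAct ((α_ _ _ _).inv ≫ (β_ (genObj G) (genObj G)).hom ▷ tensorPow (genObj G) n ≫
        (α_ _ _ _).hom) (j, x) = _
      rw [← tensorHom_id, homAct_comp, homAct_comp, homAct_tensorHom]
      change (if (j : ℕ) < 2 then ((if (j : ℕ) < 1 then (j : ℕ) + 1 else if (j : ℕ) < 2 then
        (j : ℕ) - 1 else (j : ℕ)), x) else ((j : ℕ) - 2 + 2, x)) = _
      rw [Equiv.swap_apply_def]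
      simp only [Fin.ext_iff, zero_add]
      split_ifs <;> refine Prod.ext ?_ rfl <;> dsimp only at * <;> omega
    · have hswap : Equiv.swap (⟨i + 1, Nat.lt_of_succ_lt hi⟩ : Fin (n + 2)) ⟨i + 1 + 1, hi⟩ =
          succPerm _ (Equiv.swap ⟨i, by omega⟩ ⟨i + 1, by omega⟩) := by
        rw [succPerm_swap]; rfl
      change homAct (genObj G ◁ (elementaryBraiding (genObj G) (n + 1) i).asHom) (j, x) = _
      rw [← id_tensorHom, homAct_tensorHom, hswap]
      induction j using Fin.cases with
      | zero => rfl
      | succ j =>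
        have h := ih i (by omega) j
        change ((homAct (elementaryBraiding (genObj G) (n + 1) i).asHom ((j : ℕ), x)).1 + 1,
          (homAct (elementaryBraiding (genObj G) (n + 1) i).asHom ((j : ℕ), x)).2) = _
        rw [h, succPerm_succ]
        rfl

/-- Any homomorphism with the prescribed values on the adjacent transpositions sends `σ` to a
morphism that moves positions by `σ` and leaves the labels alone. -/
lemma homAct_perm (n : ℕ) (P : Equiv.Perm (Fin n) →* End (tensorPow (genObj G) n))
    (hP : ∀ (i : ℕ) (hi : i + 1 < n),
      P (Equiv.swap ⟨i, Nat.lt_of_succ_lt hi⟩ ⟨i + 1, hi⟩) = elementaryBraiding (genObj G) n i)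
    (σ : Equiv.Perm (Fin n)) (j : Fin n) (x : G) :
    homAct (P σ).asHom (j, x) = ((σ j : ℕ), x) := by
  induction σ using perm_induction generalizing j with
  | one => rw [map_one P]; rfl
  | mul σ τ hσ hτ =>
    rw [map_mul]
    change homAct ((P τ).asHom ≫ (P σ).asHom) (j, x) = _
    rw [homAct_comp, Function.comp_apply, hτ, hσ]
    rfl
  | swap i hi => rw [hP, homAct_elementaryBraiding]

end WreathAction

/-! ### Endomorphisms of tensor powers of the generator -/

section TensorPowers

variable (G : Type w) [Group G]

/-- The submonoid of the endomorphisms of `A^{⊗ n}` generated by the tensor products of elements of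
`G` and the elementary braidings. -/
def wreathSubmonoid (n : ℕ) : Submonoid (End (tensorPow (genObj G) n)) :=
  Submonoid.closure ({f | ∃ g : Fin n → G, f = tensorPowMap n fun i => genEnd (g i)} ∪
    {f | ∃ i, i + 1 < n ∧ f = elementaryBraiding (genObj G) n i})

variable {G}

lemma genEnd_one : genEnd (1 : G) = 1 :=
  (incl (SingleObj G)).map_id (SingleObj.star G)

lemma genEnd_mul (g h : G) : genEnd (g * h) = genEnd g * genEnd h :=
  (incl (SingleObj G)).map_comp (SingleObj.toEnd G h) (SingleObj.toEnd G g)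

lemma tensorEnd_genEnd_one_mem (n : ℕ) (g : G) :
    tensorEnd (genEnd g) (1 : End (tensorPow (genObj G) n)) ∈ wreathSubmonoid G (n + 1) := by
  refine Submonoid.subset_closure (Or.inl ⟨Fin.cons g 1, ?_⟩)
  refine Eq.trans ?_ (tensorPowMap_succ _ _).symm
  simp only [Fin.cons_zero, Fin.cons_succ, Pi.one_apply, genEnd_one]
  exact congrArg (tensorEnd _) (map_one (tensorPowHom (genObj G) n)).symm

lemma whiskerEnd_mem (n : ℕ) {f : End (tensorPow (genObj G) n)} (hf : f ∈ wreathSubmonoid G n) :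
    whiskerEnd (genObj G) _ f ∈ wreathSubmonoid G (n + 1) := by
  suffices h : wreathSubmonoid G n ≤
      (show Submonoid (End (genObj G ⊗ tensorPow (genObj G) n)) from
        wreathSubmonoid G (n + 1)).comap (whiskerEnd (genObj G) (tensorPow (genObj G) n)) from h hf
  refine Submonoid.closure_le.2 ?_
  rintro _ (⟨g, rfl⟩ | ⟨i, hi, rfl⟩)
  · refine Submonoid.subset_closure (Or.inl ⟨Fin.cons 1 g, ?_⟩)
    refine Eq.trans ?_ (tensorPowMap_succ _ _).symm
    simp only [Fin.cons_zero, Fin.cons_succ, genEnd_one]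
    exact whiskerEnd_apply _
  · refine Submonoid.subset_closure (Or.inr ⟨i + 1, by omega, ?_⟩)
    obtain _ | n := n
    · omega
    · rfl

/-- All objects of the category are tensor powers of the generator. -/
lemma eq_tensorPow (X : FreeSSMC (SingleObj G)) :
    X = tensorPow (genObj G) (List.length X) := by
  induction X with
  | nil => rfl
  | cons a X ih => exact congrArg (List.cons (SingleObj.star G)) ih

lemma eq_of_hom {X Y : FreeSSMC (SingleObj G)} (f : X ⟶ Y) : X = Y := by
  obtain ⟨f⟩ := f
  exact (eq_tensorPow X).trans ((congrArg _ f.length_eq).trans (eq_tensorPow Y).symm)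

lemma exists_eq_tensorPow_of_cons {a : SingleObj G} {X : FreeSSMC (SingleObj G)} {n : ℕ}
    (h : (incl (SingleObj G)).obj a ⊗ X = tensorPow (genObj G) n) :
    ∃ m, n = m + 1 ∧ X = tensorPow (genObj G) m := by
  obtain _ | m := n
  · exact absurd h (List.cons_ne_nil _ _)
  · exact ⟨m, rfl, (List.cons.inj h).2⟩

/-- The equalities of objects are hypotheses since the objects of an arbitrary morphism are tensor
powers only propositionally. -/
lemma mem_of_isGenerated {X Y : FreeSSMC (SingleObj G)} {f : X ⟶ Y} (hf : IsGenerated f) (n : ℕ)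
    (hX : X = tensorPow (genObj G) n) (hY : Y = tensorPow (genObj G) n) :
    End.of (eqToHom hX.symm ≫ f ≫ eqToHom hY) ∈ wreathSubmonoid G n := by
  induction hf generalizing n with
  | id X =>
    subst hX
    simpa using (wreathSubmonoid G n).one_mem
  | @comp X Y Z f g hf hg ihf ihg =>
    obtain rfl := eq_of_hom g
    have h := (wreathSubmonoid G n).mul_mem (ihg n hY hY) (ihf n hX hY)
    rw [End.mul_def] at h
    simpa using h
  | @whiskerLeft a X Y f hf ih =>
    obtain ⟨m, rfl, rfl⟩ := exists_eq_tensorPow_of_cons hX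
    obtain rfl := eq_of_hom f
    have h := whiskerEnd_mem m (ih m rfl rfl)
    rw [eqToHom_refl, Category.id_comp, Category.comp_id] at h
    have e : eqToHom hX.symm ≫ (incl (SingleObj G)).obj a ◁ f ≫ eqToHom hY =
        (incl (SingleObj G)).obj a ◁ f := (Category.id_comp _).trans (Category.comp_id _)
    rw [e]
    exact h
  | @of a b f X =>
    obtain ⟨m, rfl, rfl⟩ := exists_eq_tensorPow_of_cons hX
    have h := tensorEnd_genEnd_one_mem m (show G from f)
    have e : eqToHom hX.symm ≫ (incl (SingleObj G)).map f ▷ _ ≫ eqToHom hY =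
        (incl (SingleObj G)).map f ▷ _ := (Category.id_comp _).trans (Category.comp_id _)
    rw [e]
    exact h
  | braid a b X =>
    obtain ⟨m, rfl, h2⟩ := exists_eq_tensorPow_of_cons hX
    obtain ⟨m, rfl, rfl⟩ := exists_eq_tensorPow_of_cons h2
    exact Submonoid.subset_closure (Or.inr ⟨0, by omega, rfl⟩)

lemma mem_wreathSubmonoid (n : ℕ) (f : End (tensorPow (genObj G) n)) : f ∈ wreathSubmonoid G n := by
  have h := mem_of_isGenerated (isGenerated f.asHom) n rfl rfl
  rwa [eqToHom_refl, Category.id_comp, Category.comp_id] at h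

end TensorPowers

end FreeSSMC

/-! ### The isomorphism with the wreath product -/

section WreathHom

variable {G : Type w} [Group G] {n : ℕ}

/-- Conjugation by `P σ` permutes the factors of `g₁ ⊗ ⋯ ⊗ gₙ`. -/
lemma perm_mul_tensorPowMap
    (P : Equiv.Perm (Fin n) →* End (tensorPow (genObj G) n))
    (hP : ∀ (i : ℕ) (hi : i + 1 < n),
      P (Equiv.swap ⟨i, Nat.lt_of_succ_lt hi⟩ ⟨i + 1, hi⟩) = elementaryBraiding (genObj G) n i)
    (σ : Equiv.Perm (Fin n)) (g : Fin n → End (genObj G)) :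
    P σ * tensorPowMap n g = tensorPowMap n (fun i => g (σ⁻¹ i)) * P σ := by
  induction σ using perm_induction generalizing g with
  | one => simp
  | mul σ τ hσ hτ =>
    rw [map_mul, mul_assoc, hτ, ← mul_assoc, hσ, mul_assoc, mul_inv_rev]
    rfl
  | swap i hi => rw [hP, elementaryBraiding_mul_tensorPowMap _ _ _ hi, Equiv.swap_inv]

/-- The homomorphism `(g₁, …, gₙ; σ) ↦ (g₁ ⊗ ⋯ ⊗ gₙ) ∘ P σ`. -/
lemma exists_wreathHom
    (P : Equiv.Perm (Fin n) →* End (tensorPow (genObj G) n))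
    (hP : ∀ (i : ℕ) (hi : i + 1 < n),
      P (Equiv.swap ⟨i, Nat.lt_of_succ_lt hi⟩ ⟨i + 1, hi⟩) = elementaryBraiding (genObj G) n i) :
    ∃ e : WreathProduct G n →* End (tensorPow (genObj G) n),
      ∀ p, e p = tensorPowMap n (fun i => genEnd (p.left i)) * P p.right := by
  have h1 := map_one (tensorPowHom (genObj G) n)
  refine ⟨⟨⟨fun p => tensorPowMap n (fun i => genEnd (p.left i)) * P p.right, ?_⟩, fun p q => ?_⟩,
    fun p => rfl⟩
  · simp only [SemidirectProduct.one_left, SemidirectProduct.one_right, map_one, mul_one,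
      Pi.one_apply, FreeSSMC.genEnd_one]
    exact h1
  · have h := map_mul (tensorPowHom (genObj G) n) (fun i => genEnd (p.left i))
      fun i => genEnd (q.left (p.right⁻¹ i))
    simp only [SemidirectProduct.mul_right, map_mul]
    rw [mul_assoc _ (P p.right), ← mul_assoc (P p.right), perm_mul_tensorPowMap P hP,
      ← mul_assoc, ← mul_assoc, ← mul_assoc]
    congr 2
    refine Eq.trans (congrArg (tensorPowMap n) ?_) h
    funext i
    exact FreeSSMC.genEnd_mul _ _

end WreathHom

theorem mainTheorem2 (G : Type w) [Group G] (n : ℕ) :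
    ∃ (P : Equiv.Perm (Fin n) →* End (tensorPow (genObj G) n))
      (e : WreathProduct G n ≃* End (tensorPow (genObj G) n)),
      (∀ (i : ℕ) (hi : i + 1 < n),
        P (Equiv.swap ⟨i, Nat.lt_of_succ_lt hi⟩ ⟨i + 1, hi⟩) =
          elementaryBraiding (genObj G) n i) ∧
      (∀ p : WreathProduct G n,
        e p = tensorPowMap n (fun i => genEnd (p.left i)) * P p.right) ∧
      (∀ f : End (tensorPow (genObj G) n), ∃! q : (Fin n → G) × Equiv.Perm (Fin n),
        f = tensorPowMap n (fun i => genEnd (q.1 i)) * P q.2) := by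
  obtain ⟨P, hP⟩ := exists_perm_hom_of_coxeter n (elementaryBraiding (genObj G) n)
    (fun i _ => elementaryBraiding_mul_self _ n i) (elementaryBraiding_braid _ n)
    (elementaryBraiding_comm _ n)
  obtain ⟨e, he⟩ := exists_wreathHom P hP
  have hact (p : WreathProduct G n) (j : Fin n) :
      FreeSSMC.homAct (e p).asHom (j, 1) = ((p.right j : ℕ), p.left (p.right j)) := by
    rw [he]
    change FreeSSMC.homAct ((P p.right).asHom ≫
      (tensorPowMap n fun i => genEnd (p.left i)).asHom) (j, 1) = _
    rw [FreeSSMC.homAct_comp, Function.comp_apply, FreeSSMC.homAct_perm n P hP,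
      FreeSSMC.homAct_tensorPowMap, mul_one]
  -- The value at `(j, 1)` determines `σ j` and `g (σ j)`.
  have hinj : Function.Injective e := by
    intro p q hpq
    have h (j : Fin n) := (hact p j).symm.trans ((congrArg
      (fun f : End _ => FreeSSMC.homAct f.asHom (j, 1)) hpq).trans (hact q j))
    have hr : p.right = q.right := Equiv.ext fun j => Fin.ext (Prod.ext_iff.1 (h j)).1
    refine SemidirectProduct.ext (funext fun j => ?_) hr
    have := (Prod.ext_iff.1 (h (p.right⁻¹ j))).2
    simpa [← hr] using this
  have hsurj : Function.Surjective e := by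
    rw [← MonoidHom.mrange_eq_top, ← top_le_iff]
    intro f _
    refine (Submonoid.closure_le (S := MonoidHom.mrange e)).2 ?_
      (FreeSSMC.mem_wreathSubmonoid n f)
    rintro _ (⟨g, rfl⟩ | ⟨i, hi, rfl⟩)
    · exact ⟨⟨g, 1⟩, by rw [he, map_one, mul_one]⟩
    · refine ⟨⟨1, Equiv.swap ⟨i, Nat.lt_of_succ_lt hi⟩ ⟨i + 1, hi⟩⟩, ?_⟩
      rw [he, hP]
      simp only [Pi.one_apply, FreeSSMC.genEnd_one]
      exact (congrArg (· * _) (map_one (tensorPowHom (genObj G) n))).trans (one_mul _)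
  refine ⟨P, MulEquiv.ofBijective e ⟨hinj, hsurj⟩, hP, he, fun f => ?_⟩
  obtain ⟨p, rfl⟩ := hsurj f
  refine ⟨(p.left, p.right), he p, fun q hq => ?_⟩
  have h : p = ⟨q.1, q.2⟩ := hinj (hq.trans (he ⟨q.1, q.2⟩).symm)
  rw [h]
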